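/- Let $\mu$ be a probability distribution on $\mathbb{R}^D$ and let $\tilde\rho_*(x,t)>0$, $(x,t)\in\mathbb{R}^D\times[0,1]$, be a continuously differentiable path of unnormalized densities, each integrable in $x$, that starts at $\mu$, i.e. $\tilde\rho_*(\cdot,0)$ is the (normalized) Lebesgue density of $\mu$. Put $\mathcal{Z}(t)=\int\tilde\rho_*(x,t)\,dx$, $\rho_*=\tilde\rho_*/\mathcal{Z}$, $S_*=\nabla_x\log\rho_*$, and let $\rho_*(t)$ be the distribution with density $\rho_*(\cdot,t)$. Let $v_\theta:\mathbb{R}^D\times[0,1]\to\mathbb{R}^D$ be a velocity field that is continuous and is differentiable in $x$ with a jointly continuous Jacobian, and assume that for every $x_0\in\mathbb{R}^D$ there is a trajectory $x(\cdot\,;x_0)$ on $[0,1]$ with $\dot x(t)=v_\theta(x(t),t)$, $x(0)=x_0$. Let $\rho_\theta(t)$ be the law of $x(t;x_0)$ for $x_0\sim\mu$. Define $$\varepsilon(x,t)=\nabla_x\cdot v_\theta+S_*\cdot v_\theta+\partial_t\log\tilde\rho_*-\mathbb{E}_{x'\sim\rho_*(t)}[\partial_t\log\tilde\rho_*(x',t)],\qquad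 \epsilon(x,t)=\nabla_x\cdot v_\theta+S_*\cdot v_\theta+\partial_t\log\tilde\rho_*,$$ $$\tilde w(t;x_0)=\exp\Big(\int_0^t\varepsilon(x(s;x_0),s)\,ds\Big),\qquad \varpi(t;x_0)=\exp\Big(\int_0^t\epsilon(x(s;x_0),s)\,ds\Big).$$ Let $t\in[0,1]$ and suppose that $\partial_s\log\tilde\rho_*(\cdot,s)$ is integrable with respect to $\rho_*(s)$ for all $s\in[0,t]$, that $\rho_\theta(t)$ dominates $\rho_*(t)$, i.e. $\rho_*(t)\ll\rho_\theta(t)$, and that there are constants $M_1,M_2$ with $|\tilde w(s;x_0)|<M_1$ and $|\partial_s\log\tilde\rho_*(x,s)|<M_2$ for all $s\in[0,t]$ and $x_0,x\in\mathbb{R}^D$. Then the integrals defining $\tilde w(t;x_0)$ and $\varpi(t;x_0)$ exist, and $$\varpi(t;x_0)=\tilde w(t;x_0)\,\mathcal{Z}(t)\quad\text{for every }x_0\in\mathbb{R}^D.$$ Moreover, for every $N\ge1$ and i.i.d. samples $x_0^{(1)},\dots,x_0^{(N)}\sim\mu$, the average $\hat{\mathcal{Z}}(t)=\frac1N\sum_{i=1}^N\varpi(t;x_0^{(i)})$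 is an unbiased estimator of $\mathcal{Z}(t)$: it is integrable and $\mathbb{E}[\hat{\mathcal{Z}}(t)]=\mathcal{Z}(t)$. -/

import Mathlib

open MeasureTheory ProbabilityTheory Set
open scoped ENNReal

namespace LFIS

/-- The state space `ℝ^D` with its Euclidean norm and Lebesgue measure. -/
abbrev State (D : ℕ) : Type := EuclideanSpace ℝ (Fin D)

noncomputable section

/-- The normalization constant (marginalized likelihood) `Z(t) = ∫ ρ̃(x,t) dx`. -/
def Z {D : ℕ} (ρ : ℝ → State D → ℝ) (t : ℝ) : ℝ := ∫ x, ρ t x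

/-- The normalized target density `ρ_*(x,t) = ρ̃(x,t) / Z(t)`. -/
def targetDensity {D : ℕ} (ρ : ℝ → State D → ℝ) (t : ℝ) (x : State D) : ℝ := ρ t x / Z ρ t

/-- The target distribution `ρ_*(t)`, the measure with Lebesgue density `ρ_*(·,t)`. -/
def target {D : ℕ} (ρ : ℝ → State D → ℝ) (t : ℝ) : Measure (State D) :=
  volume.withDensity fun x => ENNReal.ofReal (targetDensity ρ t x)

/-- A path `t ↦ ρ̃(·,t)`, `t ∈ [0,1]`, of unnormalized target densities on `ℝ^D` starting at the
(normalized) initial distribution `μ`: positive, integrable, and continuously differentiable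
in `(t,x)` on `[0,1] × ℝ^D`. -/
structure IsDensityPath {D : ℕ} (ρ : ℝ → State D → ℝ) (μ : Measure (State D)) : Prop where
  pos : ∀ t ∈ Icc (0 : ℝ) 1, ∀ x, 0 < ρ t x
  integrable : ∀ t ∈ Icc (0 : ℝ) 1, Integrable (ρ t) volume
  contDiffOn : ContDiffOn ℝ 1 (fun p : ℝ × State D => ρ p.1 p.2) (Icc (0 : ℝ) 1 ×ˢ univ)
  initial : μ = volume.withDensity fun x => ENNReal.ofReal (ρ 0 x)

/-- A velocity field on `[0,1] × ℝ^D`: continuous in `(t,x)`, and differentiable in `x` with a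
Jacobian that is continuous in `(t,x)`. -/
structure IsVelocityField {D : ℕ} (v : ℝ → State D → State D) : Prop where
  continuousOn : ContinuousOn (fun p : ℝ × State D => v p.1 p.2) (Icc (0 : ℝ) 1 ×ˢ univ)
  differentiable : ∀ t ∈ Icc (0 : ℝ) 1, Differentiable ℝ (v t)
  continuousOn_fderiv :
    ContinuousOn (fun p : ℝ × State D => fderiv ℝ (v p.1) p.2) (Icc (0 : ℝ) 1 ×ˢ univ)

/-- `X t x₀` is the position `x(t; x₀)` at time `t ∈ [0,1]` of the trajectory of the velocity
field `v` that starts at `x₀`: `ẋ(t) = v(x(t), t)`, `x(0) = x₀` (one-sided derivatives at the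
endpoints). -/
structure IsTrajectory {D : ℕ} (v X : ℝ → State D → State D) : Prop where
  initial : ∀ x₀, X 0 x₀ = x₀
  hasDerivWithinAt : ∀ x₀, ∀ t ∈ Icc (0 : ℝ) 1,
    HasDerivWithinAt (fun s => X s x₀) (v t (X t x₀)) (Icc (0 : ℝ) 1) t

/-- The distribution `ρ_θ(t)` induced by the velocity field: the law of `x(t; x₀)` for
`x₀ ∼ μ`. -/
def induced {D : ℕ} (μ : Measure (State D)) (X : ℝ → State D → State D) (t : ℝ) :
    Measure (State D) :=
  μ.map (X t)

/-- The divergence `∇ₓ · v(x,t) = ∑ᵢ ∂vᵢ/∂xᵢ (x,t)`. -/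
def divergence {D : ℕ} (v : ℝ → State D → State D) (t : ℝ) (x : State D) : ℝ :=
  ∑ i : Fin D, (fderiv ℝ (v t) x (EuclideanSpace.single i 1)) i

/-- The score `S_*(x,t) = ∇ₓ log ρ_*(x,t)` of the target density. -/
def score {D : ℕ} (ρ : ℝ → State D → ℝ) (t : ℝ) (x : State D) : State D :=
  gradient (fun y => Real.log (targetDensity ρ t y)) x

/-- `∂ₜ log ρ̃(x,t)` for `t ∈ [0,1]` (one-sided at the endpoints). -/
def dtLog {D : ℕ} (ρ : ℝ → State D → ℝ) (t : ℝ) (x : State D) : ℝ :=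
  derivWithin (fun s => Real.log (ρ s x)) (Icc (0 : ℝ) 1) t

/-- The error function with the centred source term,
`ε(x,t) = [∇ₓ + S_*] · v + ∂ₜ log ρ̃ - 𝔼_{ρ_*(t)}[∂ₜ log ρ̃]`. -/
def err {D : ℕ} (ρ : ℝ → State D → ℝ) (v : ℝ → State D → State D) (t : ℝ) (x : State D) : ℝ :=
  divergence v t x + inner ℝ (score ρ t x) (v t x)
    + (dtLog ρ t x - ∫ y, dtLog ρ t y ∂(target ρ t))

/-- The modified error function `ϵ(x,t) = [∇ₓ + S_*] · v + ∂ₜ log ρ̃`. -/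
def modErr {D : ℕ} (ρ : ℝ → State D → ℝ) (v : ℝ → State D → State D) (t : ℝ) (x : State D) : ℝ :=
  divergence v t x + inner ℝ (score ρ t x) (v t x) + dtLog ρ t x

/-- The unnormalized weight `w̃(t; x₀) = exp (∫₀ᵗ ε(x(s; x₀), s) ds)`. -/
def weight {D : ℕ} (ρ : ℝ → State D → ℝ) (v X : ℝ → State D → State D) (t : ℝ)
    (x₀ : State D) : ℝ :=
  Real.exp (∫ s in (0 : ℝ)..t, err ρ v s (X s x₀))

/-- The modified unnormalized weight `ϖ(t; x₀) = exp (∫₀ᵗ ϵ(x(s; x₀), s) ds)`. -/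
def modWeight {D : ℕ} (ρ : ℝ → State D → ℝ) (v X : ℝ → State D → State D) (t : ℝ)
    (x₀ : State D) : ℝ :=
  Real.exp (∫ s in (0 : ℝ)..t, modErr ρ v s (X s x₀))

/-- The estimator `Ẑ(t) = (1/N) ∑ᵢ ϖ(t; x₀⁽ⁱ⁾)` evaluated at the initial points `x₀⁽ⁱ⁾`. -/
def estimator {D N : ℕ} (ρ : ℝ → State D → ℝ) (v X : ℝ → State D → State D) (t : ℝ)
    (x₀ : Fin N → State D) : ℝ :=
  (1 / (N : ℝ)) * ∑ i : Fin N, modWeight ρ v X t (x₀ i)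

end

end LFIS

namespace LFIS

theorem hasDerivWithinAt_Ici_of_Icc {E : Type*} [NormedAddCommGroup E] [NormedSpace ℝ E]
    {f : ℝ → E} {f' : E} {a b s : ℝ} (h : HasDerivWithinAt f f' (Icc a b) s)
    (hs : s ∈ Ico a b) : HasDerivWithinAt f f' (Ici s) s :=
  (h.mono (Icc_subset_Icc_left hs.1)).mono_of_mem_nhdsWithin (Icc_mem_nhdsGE hs.2)

/-- Coordinatewise truncation of a vector to the cube `[-R, R]^ι`. -/
def clamp {ι : Type*} (R : ℝ) (x : ι → ℝ) : ι → ℝ := fun i => max (-R) (min R (x i))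

section clamp

variable {ι : Type*} [Fintype ι]

theorem lipschitzWith_clamp (R : ℝ) : LipschitzWith 1 (clamp R : (ι → ℝ) → ι → ℝ) := by
  refine LipschitzWith.of_dist_le_mul fun x y => ?_
  rw [NNReal.coe_one, one_mul]
  refine (dist_pi_le_iff dist_nonneg).2 fun i => ?_
  refine le_trans ?_ (dist_le_pi_dist x y i)
  simp only [clamp, Real.dist_eq]
  rw [max_comm (-R), max_comm (-R), min_comm R, min_comm R]
  exact (abs_max_sub_max_le_abs _ _ _).trans (abs_inf_sub_inf_le_abs _ _ _)

theorem norm_clamp_le {R : ℝ} (hR : 0 ≤ R) (x : ι → ℝ) : ‖clamp R x‖ ≤ R := by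
  refine (pi_norm_le_iff_of_nonneg hR).2 fun i => ?_
  rw [Real.norm_eq_abs, abs_le]
  exact ⟨le_max_left _ _, max_le (by linarith) (min_le_left _ _)⟩

theorem clamp_eq_self {R : ℝ} {x : ι → ℝ} (hx : ‖x‖ ≤ R) : clamp R x = x := by
  funext i
  have := abs_le.1 ((norm_le_pi_norm x i).trans hx)
  simp [clamp, this.1, this.2]

theorem norm_clamp_le_norm {R : ℝ} (hR : 0 ≤ R) (x : ι → ℝ) : ‖clamp R x‖ ≤ ‖x‖ := by
  have h0 : clamp R (0 : ι → ℝ) = 0 := clamp_eq_self (by simpa using hR)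
  simpa [h0] using (lipschitzWith_clamp R).dist_le_mul x 0

end clamp

/-- A linear differential equation with continuous coefficients has a solution on the whole
interval (coordinate form). -/
theorem exists_solution_linear_pi {ι : Type*} [Fintype ι]
    {A : ℝ → (ι → ℝ) →L[ℝ] (ι → ℝ)} (hA : ContinuousOn A (Icc 0 1)) (x₀ : ι → ℝ) :
    ∃ c : ℝ → ι → ℝ, c 0 = x₀ ∧
      ∀ t ∈ Icc (0 : ℝ) 1, HasDerivWithinAt c (A t (c t)) (Icc 0 1) t := by
  obtain ⟨K, hK⟩ := isCompact_Icc.exists_bound_of_continuousOn hA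
  have hK0 : 0 ≤ K := (norm_nonneg _).trans (hK 0 (by simp))
  set R : ℝ := ‖x₀‖ * Real.exp K with hR
  have hR0 : 0 ≤ R := by positivity
  have hlip : ∀ s ∈ Icc (0 : ℝ) 1, LipschitzWith K.toNNReal (fun x => A s (clamp R x)) := by
    intro s hs
    have h1 : LipschitzWith K.toNNReal (A s) :=
      (A s).lipschitz.weaken (by
        rw [← NNReal.coe_le_coe, Real.coe_toNNReal _ hK0]; exact hK s hs)
    simpa [Function.comp_def] using h1.comp (lipschitzWith_clamp R)
  have hPL : IsPicardLindelof (fun s x => A s (clamp R x)) (⟨0, by simp⟩ : Icc (0 : ℝ) 1) x₀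
      (K * R).toNNReal 0 (K * R).toNNReal K.toNNReal := by
    refine ⟨fun s hs => (hlip s hs).lipschitzOnWith, fun x _ => ?_, fun s hs x _ => ?_, ?_⟩
    · exact hA.clm_apply continuousOn_const
    · rw [Real.coe_toNNReal _ (by positivity)]
      exact ((A s).le_opNorm _).trans
        (mul_le_mul (hK s hs) (norm_clamp_le hR0 x) (norm_nonneg _) hK0)
    · simp
  obtain ⟨c, hc0, hc⟩ := hPL.exists_eq_forall_mem_Icc_hasDerivWithinAt₀
  refine ⟨c, hc0, fun t ht => ?_⟩
  have hbound : ∀ s ∈ Icc (0 : ℝ) 1, ‖c s‖ ≤ R := by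
    intro s hs
    have := norm_le_gronwallBound_of_norm_deriv_right_le (δ := ‖x₀‖) (K := K) (ε := 0)
      (fun s hs => (hc s hs).continuousWithinAt)
      (fun s hs => hasDerivWithinAt_Ici_of_Icc (hc s ⟨hs.1, hs.2.le⟩) hs) (by
        change c 0 = x₀ at hc0; rw [hc0])
      (fun s hs => by
        rw [add_zero]
        exact ((A s).le_opNorm _).trans (mul_le_mul (hK s ⟨hs.1, hs.2.le⟩)
          (norm_clamp_le_norm hR0 _) (norm_nonneg _) hK0)) s hs
    rw [gronwallBound_ε0, sub_zero] at this
    refine this.trans (mul_le_mul_of_nonneg_left (Real.exp_le_exp.2 ?_) (norm_nonneg _))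
    nlinarith [hs.2]
  have := hc t ht
  rwa [clamp_eq_self (hbound t ht)] at this

/-- A linear differential equation with continuous coefficients has a solution on the whole
interval. -/
theorem exists_solution_linear {D : ℕ} {A : ℝ → State D →L[ℝ] State D}
    (hA : ContinuousOn A (Icc 0 1)) (x₀ : State D) :
    ∃ c : ℝ → State D, c 0 = x₀ ∧
      ∀ t ∈ Icc (0 : ℝ) 1, HasDerivWithinAt c (A t (c t)) (Icc 0 1) t := by
  let e := EuclideanSpace.equiv (Fin D) ℝ
  obtain ⟨c, hc0, hc⟩ := exists_solution_linear_pi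
    (A := fun s => (e : State D →L[ℝ] (Fin D → ℝ)).comp
      ((A s).comp (e.symm : (Fin D → ℝ) →L[ℝ] State D)))
    (continuousOn_const.clm_comp (hA.clm_comp continuousOn_const)) (e x₀)
  refine ⟨fun s => e.symm (c s), by simp [hc0], fun t ht => ?_⟩
  have := (e.symm : (Fin D → ℝ) →L[ℝ] State D).hasFDerivAt.comp_hasDerivWithinAt t (hc t ht)
  simpa [Function.comp_def] using! this

/-- Jacobi's formula for the derivative of the determinant of a solution of `M' = A M`. -/
theorem hasDerivWithinAt_det {ι : Type*} [Fintype ι] [DecidableEq ι]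
    {M : ℝ → Matrix ι ι ℝ} {A : Matrix ι ι ℝ} {S : Set ℝ} {t : ℝ}
    (hM : ∀ i j, HasDerivWithinAt (fun s => M s i j) ((A * M t) i j) S t) :
    HasDerivWithinAt (fun s => (M s).det) (A.trace * (M t).det) S t := by
  let f : ContinuousMultilinearMap ℝ (fun _ : ι => ι → ℝ) ℝ :=
    { (Matrix.detRowAlternating (R := ℝ) (n := ι)).toMultilinearMap with
      cont := Continuous.matrix_det (A := fun m : ι → ι → ℝ => Matrix.of m) continuous_id }
  have hf : ∀ m : ι → ι → ℝ, f m = Matrix.det (Matrix.of m) := fun _ => rfl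
  have hM' : HasDerivWithinAt (fun s => (fun i j => M s i j)) (fun i j => (A * M t) i j) S t :=
    hasDerivWithinAt_pi.2 fun i => hasDerivWithinAt_pi.2 fun j => hM i j
  have h := (f.hasFDerivAt (fun i j => M t i j)).comp_hasDerivWithinAt t hM'
  refine h.congr_deriv ?_
  symm
  rw [ContinuousMultilinearMap.linearDeriv_apply, Matrix.trace, Finset.sum_mul]
  refine Finset.sum_congr rfl fun i _ => ?_
  have hrow : (fun j => (A * M t) i j) = ∑ k, A i k • (M t) k := by
    funext j
    simp [Matrix.mul_apply]
  have := Matrix.det_updateRow_sum (M t) i (fun k => A i k)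
  rw [smul_eq_mul] at this
  rw [Matrix.diag_apply, ← this, hf, hrow]
  rfl

/-- Liouville's formula: a solution of `M' = A M` with `M 0 = 1` has determinant
`exp (∫ trace A)`. -/
theorem det_eq_exp_integral_trace {ι : Type*} [Fintype ι] [DecidableEq ι]
    {M A : ℝ → Matrix ι ι ℝ} (h0 : M 0 = 1)
    (hM : ∀ t ∈ Icc (0 : ℝ) 1, ∀ i j,
      HasDerivWithinAt (fun s => M s i j) ((A t * M t) i j) (Icc 0 1) t)
    (hA : ContinuousOn (fun s => (A s).trace) (Icc 0 1)) {t : ℝ} (ht : t ∈ Icc (0 : ℝ) 1) :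
    (M t).det = Real.exp (∫ s in (0 : ℝ)..t, (A s).trace) := by
  have hint : IntervalIntegrable (fun s => (A s).trace) volume 0 1 :=
    hA.intervalIntegrable_of_Icc zero_le_one
  have hI : ∀ s ∈ Icc (0 : ℝ) 1,
      HasDerivWithinAt (fun u => ∫ r in (0 : ℝ)..u, (A r).trace) ((A s).trace) (Icc 0 1) s := by
    intro s hs
    have : Fact (s ∈ Icc (0 : ℝ) 1) := ⟨hs⟩
    exact intervalIntegral.integral_hasDerivWithinAt_right
      (hint.mono_set (by rw [uIcc_of_le hs.1, uIcc_of_le zero_le_one]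
                         exact Icc_subset_Icc_right hs.2))
      (hA.stronglyMeasurableAtFilter_nhdsWithin measurableSet_Icc s) (hA s hs)
  have hder : ∀ s ∈ Icc (0 : ℝ) 1, HasDerivWithinAt
      (fun u => (M u).det * Real.exp (-∫ r in (0 : ℝ)..u, (A r).trace)) 0 (Icc 0 1) s := by
    intro s hs
    refine ((hasDerivWithinAt_det (hM s hs)).mul (hI s hs).fun_neg.exp).congr_deriv ?_
    ring
  have hconst := constant_of_has_deriv_right_zero
    (fun s hs => (hder s hs).continuousWithinAt)
    (fun s hs => hasDerivWithinAt_Ici_of_Icc (hder s ⟨hs.1, hs.2.le⟩) hs) t ht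
  simp only [h0, Matrix.det_one, intervalIntegral.integral_same, neg_zero, Real.exp_zero,
    mul_one] at hconst
  rw [Real.exp_neg] at hconst
  field_simp at hconst
  exact hconst

section flow

variable {D : ℕ} {v X : ℝ → State D → State D}

theorem IsTrajectory.continuousOn (hX : IsTrajectory v X) (x : State D) :
    ContinuousOn (fun s => X s x) (Icc 0 1) :=
  fun s hs => (hX.hasDerivWithinAt x s hs).continuousWithinAt

theorem IsTrajectory.hasDerivWithinAt_Ici (hX : IsTrajectory v X) (x : State D) {s : ℝ}
    (hs : s ∈ Ico (0 : ℝ) 1) : HasDerivWithinAt (fun s => X s x) (v s (X s x)) (Ici s) s :=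
  hasDerivWithinAt_Ici_of_Icc (hX.hasDerivWithinAt x s ⟨hs.1, hs.2.le⟩) hs

theorem IsVelocityField.exists_norm_fderiv_le (hv : IsVelocityField v) (R : ℝ) :
    ∃ K : ℝ, 1 ≤ K ∧ ∀ s ∈ Icc (0 : ℝ) 1, ∀ x, ‖x‖ ≤ R → ‖fderiv ℝ (v s) x‖ ≤ K := by
  have hc : IsCompact (Icc (0 : ℝ) 1 ×ˢ Metric.closedBall (0 : State D) R) :=
    isCompact_Icc.prod (isCompact_closedBall _ _)
  obtain ⟨K, hK⟩ := hc.exists_bound_of_continuousOn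
    (hv.continuousOn_fderiv.mono (prod_mono_right (subset_univ _)))
  exact ⟨max 1 K, le_max_left _ _, fun s hs x hx =>
    (hK (s, x) ⟨hs, by simpa using hx⟩).trans (le_max_right _ _)⟩

theorem IsVelocityField.exists_norm_fderiv_sub_le (hv : IsVelocityField v) (R : ℝ) {ε : ℝ}
    (hε : 0 < ε) :
    ∃ δ > 0, ∀ s ∈ Icc (0 : ℝ) 1, ∀ x y, ‖x‖ ≤ R → ‖y‖ ≤ R → ‖x - y‖ < δ →
      ‖fderiv ℝ (v s) x - fderiv ℝ (v s) y‖ ≤ ε := by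
  have hc : IsCompact (Icc (0 : ℝ) 1 ×ˢ Metric.closedBall (0 : State D) R) :=
    isCompact_Icc.prod (isCompact_closedBall _ _)
  have hu := hc.uniformContinuousOn_of_continuous
    (hv.continuousOn_fderiv.mono (prod_mono_right (subset_univ _)))
  obtain ⟨δ, hδ, h⟩ := Metric.uniformContinuousOn_iff.1 hu ε hε
  refine ⟨δ, hδ, fun s hs x y hx hy hxy => ?_⟩
  have := h (s, x) ⟨hs, by simpa using hx⟩ (s, y) ⟨hs, by simpa using hy⟩
    (by simpa [Prod.dist_eq, hδ, dist_eq_norm] using hxy)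
  simpa [dist_eq_norm] using this.le

/-- Distinct initial points stay distinct along the flow. -/
theorem IsTrajectory.injective (hv : IsVelocityField v) (hX : IsTrajectory v X) {t : ℝ}
    (ht : t ∈ Icc (0 : ℝ) 1) : Function.Injective (X t) := by
  intro x y hxy
  obtain ⟨R₁, hR₁⟩ := isCompact_Icc.exists_bound_of_continuousOn (hX.continuousOn x)
  obtain ⟨R₂, hR₂⟩ := isCompact_Icc.exists_bound_of_continuousOn (hX.continuousOn y)
  obtain ⟨K, hK1, hK⟩ := hv.exists_norm_fderiv_le (max R₁ R₂)
  have hsub : Icc 0 t ⊆ Icc (0 : ℝ) 1 := Icc_subset_Icc_right ht.2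
  have hlip : ∀ s ∈ Ioc (0 : ℝ) t,
      LipschitzOnWith K.toNNReal (v s) (Metric.closedBall 0 (max R₁ R₂)) := by
    intro s hs
    have hs1 : s ∈ Icc (0 : ℝ) 1 := hsub ⟨hs.1.le, hs.2⟩
    refine (convex_closedBall _ _).lipschitzOnWith_of_nnnorm_fderiv_le
      (𝕜 := ℝ) (fun z _ => hv.differentiable s hs1 z) fun z hz => ?_
    rw [← NNReal.coe_le_coe, Real.coe_toNNReal _ (by linarith), coe_nnnorm]
    exact hK s hs1 z (by simpa using hz)
  have hd : ∀ z, ∀ s ∈ Ioc (0 : ℝ) t,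
      HasDerivWithinAt (fun s => X s z) (v s (X s z)) (Iic s) s := fun z s hs =>
    ((hX.hasDerivWithinAt z s (hsub ⟨hs.1.le, hs.2⟩)).mono
      (Icc_subset_Icc_right (hs.2.trans ht.2))).mono_of_mem_nhdsWithin
      (Icc_mem_nhdsLE hs.1)
  have := ODE_solution_unique_of_mem_Icc_left (s := fun _ => Metric.closedBall 0 (max R₁ R₂))
    hlip ((hX.continuousOn x).mono hsub) (hd x)
    (fun s hs => by simpa using Or.inl (hR₁ s (hsub ⟨hs.1.le, hs.2⟩)))
    ((hX.continuousOn y).mono hsub) (hd y)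
    (fun s hs => by simpa using Or.inr (hR₂ s (hsub ⟨hs.1.le, hs.2⟩))) hxy
    (left_mem_Icc.2 ht.1)
  simpa [hX.initial] using this

/-- A trajectory that starts close to `x` stays close to the trajectory of `x`. -/
theorem IsTrajectory.norm_sub_le (hv : IsVelocityField v) (hX : IsTrajectory v X) {x : State D}
    {R K : ℝ} (hR : ∀ s ∈ Icc (0 : ℝ) 1, ‖X s x‖ ≤ R) (hK0 : 0 ≤ K)
    (hK : ∀ s ∈ Icc (0 : ℝ) 1, ∀ z, ‖z‖ ≤ R + 1 → ‖fderiv ℝ (v s) z‖ ≤ K) {y : State D}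
    (hy : ‖y - x‖ * Real.exp (K + 1) ≤ 1) {s : ℝ} (hs : s ∈ Icc (0 : ℝ) 1) :
    ‖X s y - X s x‖ ≤ ‖y - x‖ * Real.exp (K + 1) := by
  rcases eq_or_ne y x with rfl | hne
  · simp
  have hpos : 0 < ‖y - x‖ := norm_pos_iff.2 (sub_ne_zero.2 hne)
  have hexp : ∀ u ∈ Icc (0 : ℝ) 1,
      ‖y - x‖ * Real.exp ((K + 1) * u) ≤ ‖y - x‖ * Real.exp (K + 1) := fun u hu =>
    mul_le_mul_of_nonneg_left (Real.exp_le_exp.2 (by nlinarith [hu.2])) (norm_nonneg _)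
  refine le_trans ?_ (hexp s hs)
  refine image_norm_le_of_norm_deriv_right_lt_deriv_boundary (a := 0) (b := 1)
    (f := fun u => X u y - X u x) (B := fun u => ‖y - x‖ * Real.exp ((K + 1) * u))
    (B' := fun u => ‖y - x‖ * (Real.exp ((K + 1) * u) * (K + 1)))
    ((hX.continuousOn y).sub (hX.continuousOn x))
    (fun u hu => (hX.hasDerivWithinAt_Ici y hu).sub (hX.hasDerivWithinAt_Ici x hu))
    (by simp [hX.initial]) (fun u => ?_) (fun u hu heq => ?_) hs
  · have h1 : HasDerivAt (fun u : ℝ => (K + 1) * u) (K + 1) u := by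
      simpa using (hasDerivAt_id u).const_mul (K + 1)
    exact h1.exp.const_mul _
  · have hu1 : u ∈ Icc (0 : ℝ) 1 := ⟨hu.1, hu.2.le⟩
    have hball : ‖X u y - X u x‖ ≤ 1 := heq.le.trans ((hexp u hu1).trans hy)
    have hmem : ∀ z ∈ Metric.closedBall (X u x) 1, ‖z‖ ≤ R + 1 := fun z hz => by
      have h1 := norm_le_norm_add_norm_sub' z (X u x)
      have h2 := hR u hu1
      rw [mem_closedBall_iff_norm] at hz
      linarith
    have := (convex_closedBall (X u x) 1).norm_image_sub_le_of_norm_fderiv_le (𝕜 := ℝ)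
      (fun z _ => hv.differentiable u hu1 z) (fun z hz => hK u hu1 z (hmem z hz))
      (Metric.mem_closedBall_self zero_le_one) (mem_closedBall_iff_norm.2 hball)
    have hB : 0 < ‖y - x‖ * Real.exp ((K + 1) * u) := by positivity
    rw [heq] at this
    linarith

/-- A solution of the variational equation along the trajectory of `x` is the derivative of the
flow at `x`. -/
theorem IsTrajectory.hasFDerivAt (hv : IsVelocityField v) (hX : IsTrajectory v X) {x : State D}
    {J : ℝ → State D →L[ℝ] State D} (hJ0 : J 0 = ContinuousLinearMap.id ℝ (State D))
    (hJ : ∀ h, ∀ s ∈ Icc (0 : ℝ) 1,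
      HasDerivWithinAt (fun s => J s h) (fderiv ℝ (v s) (X s x) (J s h)) (Icc 0 1) s)
    {t : ℝ} (ht : t ∈ Icc (0 : ℝ) 1) : HasFDerivAt (X t) (J t) x := by
  obtain ⟨R, hR⟩ := isCompact_Icc.exists_bound_of_continuousOn (hX.continuousOn x)
  obtain ⟨K, hK1, hK⟩ := hv.exists_norm_fderiv_le (R + 1)
  have hK0 : 0 < K := by linarith
  set C : ℝ := Real.exp (K + 1) with hC
  have hC0 : 0 < C := Real.exp_pos _
  rw [hasFDerivAt_iff_isLittleO, Asymptotics.isLittleO_iff]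
  intro c hc
  set ε : ℝ := c / (C * Real.exp K) with hε
  have hε0 : 0 < ε := by positivity
  obtain ⟨δ, hδ0, hδ⟩ := hv.exists_norm_fderiv_sub_le (R + 1) hε0
  have hnhds : ∀ᶠ y in nhds x, ‖y - x‖ < min (1 / C) (δ / C) := by
    have : Metric.ball x (min (1 / C) (δ / C)) ∈ nhds x :=
      Metric.ball_mem_nhds _ (by positivity)
    filter_upwards [this] with y hy
    simpa [dist_eq_norm] using hy
  filter_upwards [hnhds] with y hy
  have hy1 : ‖y - x‖ * C ≤ 1 := ((lt_div_iff₀ hC0).1 (hy.trans_le (min_le_left _ _))).le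
  have hyδ : ‖y - x‖ * C < δ := (lt_div_iff₀ hC0).1 (hy.trans_le (min_le_right _ _))
  have hclose : ∀ s ∈ Icc (0 : ℝ) 1, ‖X s y - X s x‖ ≤ ‖y - x‖ * C := fun s hs =>
    hX.norm_sub_le hv hR hK0.le hK hy1 hs
  have hbound : ∀ s ∈ Ico (0 : ℝ) 1,
      ‖v s (X s y) - v s (X s x) - fderiv ℝ (v s) (X s x) (J s (y - x))‖ ≤
        K * ‖X s y - X s x - J s (y - x)‖ + ε * (‖y - x‖ * C) := by
    intro s hs
    have hs1 : s ∈ Icc (0 : ℝ) 1 := ⟨hs.1, hs.2.le⟩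
    have hcl := hclose s hs1
    have hmem : ∀ z ∈ Metric.closedBall (X s x) (‖y - x‖ * C), ‖z‖ ≤ R + 1 := fun z hz => by
      have h1 := norm_le_norm_add_norm_sub' z (X s x)
      have h2 := hR s hs1
      rw [mem_closedBall_iff_norm] at hz
      linarith
    have hself : X s x ∈ Metric.closedBall (X s x) (‖y - x‖ * C) :=
      Metric.mem_closedBall_self (by positivity)
    have h1 := (convex_closedBall (X s x) (‖y - x‖ * C)).norm_image_sub_le_of_norm_fderiv_le'
      (𝕜 := ℝ) (f := v s) (φ := fderiv ℝ (v s) (X s x)) (C := ε)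
      (fun z _ => hv.differentiable s hs1 z)
      (fun z hz => hδ s hs1 z (X s x) (hmem z hz) (hmem _ hself)
        ((mem_closedBall_iff_norm.1 hz).trans_lt hyδ))
      hself (mem_closedBall_iff_norm.2 hcl)
    have h2 : ‖fderiv ℝ (v s) (X s x) (X s y - X s x - J s (y - x))‖ ≤
        K * ‖X s y - X s x - J s (y - x)‖ :=
      ((fderiv ℝ (v s) (X s x)).le_opNorm _).trans
        (mul_le_mul_of_nonneg_right (hK s hs1 _ (hmem _ hself)) (norm_nonneg _))
    have h3 : v s (X s y) - v s (X s x) - fderiv ℝ (v s) (X s x) (J s (y - x)) =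
        fderiv ℝ (v s) (X s x) (X s y - X s x - J s (y - x)) +
        (v s (X s y) - v s (X s x) - fderiv ℝ (v s) (X s x) (X s y - X s x)) := by
      rw [map_sub _ (X s y - X s x)]
      abel
    rw [h3]
    exact (norm_add_le _ _).trans (add_le_add h2
      (h1.trans (mul_le_mul_of_nonneg_left hcl hε0.le)))
  have hd : ∀ s ∈ Icc (0 : ℝ) 1, HasDerivWithinAt (fun s => X s y - X s x - J s (y - x))
      (v s (X s y) - v s (X s x) - fderiv ℝ (v s) (X s x) (J s (y - x))) (Icc 0 1) s :=
    fun s hs => ((hX.hasDerivWithinAt y s hs).sub (hX.hasDerivWithinAt x s hs)).sub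
      (hJ (y - x) s hs)
  have hg := norm_le_gronwallBound_of_norm_deriv_right_le (δ := 0)
    (fun s hs => (hd s hs).continuousWithinAt)
    (fun s hs => hasDerivWithinAt_Ici_of_Icc (hd s ⟨hs.1, hs.2.le⟩) hs)
    (by simp [hX.initial, hJ0]) hbound t ht
  refine hg.trans ?_
  rw [gronwallBound_of_K_ne_0 hK0.ne']
  simp only [zero_mul, zero_add, sub_zero]
  have he : Real.exp (K * t) - 1 ≤ Real.exp K := by
    have : Real.exp (K * t) ≤ Real.exp K := Real.exp_le_exp.2 (by nlinarith [ht.2])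
    linarith
  have h0 : 0 ≤ ε * (‖y - x‖ * C) := by positivity
  calc ε * (‖y - x‖ * C) / K * (Real.exp (K * t) - 1)
      ≤ ε * (‖y - x‖ * C) / K * Real.exp K := mul_le_mul_of_nonneg_left he (by positivity)
    _ ≤ ε * (‖y - x‖ * C) * Real.exp K :=
        mul_le_mul_of_nonneg_right (div_le_self h0 hK1) (Real.exp_pos _).le
    _ = c * ‖y - x‖ := by rw [hε]; field_simp

theorem IsVelocityField.continuousOn_divergence (hv : IsVelocityField v) (hX : IsTrajectory v X)
    (x : State D) : ContinuousOn (fun s => divergence v s (X s x)) (Icc 0 1) := by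
  have hA : ContinuousOn (fun s => fderiv ℝ (v s) (X s x)) (Icc 0 1) :=
    hv.continuousOn_fderiv.comp (continuousOn_id.prodMk (hX.continuousOn x))
      fun s hs => ⟨hs, mem_univ _⟩
  refine continuousOn_finsetSum _ fun i _ => ?_
  exact (EuclideanSpace.proj (𝕜 := ℝ) i).continuous.comp_continuousOn
    (hA.clm_apply continuousOn_const)

/-- The flow is differentiable in the initial point, and its Jacobian determinant is the
exponential of the integrated divergence along the trajectory. -/
theorem IsTrajectory.exists_hasFDerivAt (hv : IsVelocityField v) (hX : IsTrajectory v X)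
    (x : State D) {t : ℝ} (ht : t ∈ Icc (0 : ℝ) 1) :
    ∃ J : State D →L[ℝ] State D, HasFDerivAt (X t) J x ∧
      J.det = Real.exp (∫ s in (0 : ℝ)..t, divergence v s (X s x)) := by
  have hA : ContinuousOn (fun s => fderiv ℝ (v s) (X s x)) (Icc 0 1) :=
    hv.continuousOn_fderiv.comp (continuousOn_id.prodMk (hX.continuousOn x))
      fun s hs => ⟨hs, mem_univ _⟩
  choose c hc0 hc using fun j : Fin D =>
    exists_solution_linear hA (EuclideanSpace.single j (1 : ℝ))
  let b := (EuclideanSpace.basisFun (Fin D) ℝ).toBasis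
  let J : ℝ → State D →L[ℝ] State D := fun s =>
    ∑ j, (EuclideanSpace.proj (𝕜 := ℝ) j).smulRight (c j s)
  have hJapp : ∀ s h, J s h = ∑ j, h j • c j s := fun s h => by
    simp [J]
  have hJ0 : J 0 = ContinuousLinearMap.id ℝ (State D) := by
    ext h i
    rw [hJapp]
    simp [hc0, Pi.single_apply]
  have hJd : ∀ h, ∀ s ∈ Icc (0 : ℝ) 1,
      HasDerivWithinAt (fun s => J s h) (fderiv ℝ (v s) (X s x) (J s h)) (Icc 0 1) s := by
    intro h s hs
    simp only [hJapp, map_sum, map_smul]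
    exact HasDerivWithinAt.fun_sum fun j _ => (hc j s hs).fun_const_smul _
  refine ⟨J t, hX.hasFDerivAt hv hJ0 hJd ht, ?_⟩
  have hdiv : ∀ s, divergence v s (X s x) =
      (LinearMap.toMatrix b b (fderiv ℝ (v s) (X s x) : State D →ₗ[ℝ] State D)).trace := by
    intro s
    simp [divergence, Matrix.trace, LinearMap.toMatrix_apply, b]
  have hmat : ∀ s ∈ Icc (0 : ℝ) 1, ∀ i j, HasDerivWithinAt
      (fun s => LinearMap.toMatrix b b (J s : State D →ₗ[ℝ] State D) i j)
      ((LinearMap.toMatrix b b (fderiv ℝ (v s) (X s x) : State D →ₗ[ℝ] State D) *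
        LinearMap.toMatrix b b (J s : State D →ₗ[ℝ] State D)) i j) (Icc 0 1) s := by
    intro s hs i j
    rw [← LinearMap.toMatrix_comp]
    have := (EuclideanSpace.proj (𝕜 := ℝ) i).hasFDerivAt.comp_hasDerivWithinAt s
      (hJd (EuclideanSpace.single j 1) s hs)
    simpa [LinearMap.toMatrix_apply, b, Function.comp_def] using! this
  have := det_eq_exp_integral_trace (by rw [hJ0]; exact LinearMap.toMatrix_id b) hmat
    (by simpa only [← hdiv] using hv.continuousOn_divergence hX x) ht
  simp only [hdiv]
  rw [← this, LinearMap.det_toMatrix]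

end flow

section densityPath

variable {D : ℕ} {ρ : ℝ → State D → ℝ} {μ : Measure (State D)}

theorem uniqueDiffOn_strip : UniqueDiffOn ℝ (Icc (0 : ℝ) 1 ×ˢ (univ : Set (State D))) :=
  (uniqueDiffOn_Icc zero_lt_one).prod uniqueDiffOn_univ

/-- The differential of `log ρ̃` in `(t, x)`. -/
noncomputable def logDifferential (ρ : ℝ → State D → ℝ) (p : ℝ × State D) :
    (ℝ × State D) →L[ℝ] ℝ :=
  fderivWithin ℝ (fun q : ℝ × State D => Real.log (ρ q.1 q.2)) (Icc (0 : ℝ) 1 ×ˢ univ) p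

namespace IsDensityPath

theorem contDiffOn_log (hρ : IsDensityPath ρ μ) :
    ContDiffOn ℝ 1 (fun q : ℝ × State D => Real.log (ρ q.1 q.2)) (Icc (0 : ℝ) 1 ×ˢ univ) :=
  hρ.contDiffOn.log fun q hq => (hρ.pos q.1 hq.1 q.2).ne'

theorem hasFDerivWithinAt_log (hρ : IsDensityPath ρ μ) {s : ℝ} (hs : s ∈ Icc (0 : ℝ) 1)
    (x : State D) :
    HasFDerivWithinAt (fun q : ℝ × State D => Real.log (ρ q.1 q.2)) (logDifferential ρ (s, x))
      (Icc (0 : ℝ) 1 ×ˢ univ) (s, x) :=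
  ((hρ.contDiffOn_log.differentiableOn one_ne_zero) (s, x) ⟨hs, mem_univ _⟩).hasFDerivWithinAt

theorem continuousOn_logDifferential (hρ : IsDensityPath ρ μ) :
    ContinuousOn (logDifferential ρ) (Icc (0 : ℝ) 1 ×ˢ univ) :=
  hρ.contDiffOn_log.continuousOn_fderivWithin uniqueDiffOn_strip le_rfl

theorem hasDerivWithinAt_log (hρ : IsDensityPath ρ μ) {c : ℝ → State D} {c' : State D} {s : ℝ}
    (hs : s ∈ Icc (0 : ℝ) 1) (hc : HasDerivWithinAt c c' (Icc 0 1) s) :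
    HasDerivWithinAt (fun u => Real.log (ρ u (c u))) (logDifferential ρ (s, c s) (1, c'))
      (Icc 0 1) s :=
  (hρ.hasFDerivWithinAt_log hs (c s)).comp_hasDerivWithinAt (f := fun u => (u, c u)) s
    ((hasDerivWithinAt_id s _).prodMk hc) fun _ hu => ⟨hu, mem_univ _⟩

theorem dtLog_eq (hρ : IsDensityPath ρ μ) {s : ℝ} (hs : s ∈ Icc (0 : ℝ) 1) (x : State D) :
    dtLog ρ s x = logDifferential ρ (s, x) (1, 0) :=
  (hρ.hasDerivWithinAt_log (c := fun _ => x) hs (hasDerivWithinAt_const s _ x)).derivWithin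
    (uniqueDiffOn_Icc zero_lt_one s hs)

theorem continuousOn_dtLog (hρ : IsDensityPath ρ μ) :
    ContinuousOn (fun p : ℝ × State D => dtLog ρ p.1 p.2) (Icc (0 : ℝ) 1 ×ˢ univ) :=
  (hρ.continuousOn_logDifferential.clm_apply continuousOn_const).congr
    fun p hp => hρ.dtLog_eq hp.1 p.2

theorem continuous_dtLog (hρ : IsDensityPath ρ μ) {s : ℝ} (hs : s ∈ Icc (0 : ℝ) 1) :
    Continuous (dtLog ρ s) :=
  continuousOn_univ.1 (hρ.continuousOn_dtLog.comp (f := fun x => (s, x))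
    (continuousOn_const.prodMk continuousOn_id) fun _ _ => ⟨hs, mem_univ _⟩)

theorem continuous_apply (hρ : IsDensityPath ρ μ) {s : ℝ} (hs : s ∈ Icc (0 : ℝ) 1) :
    Continuous (ρ s) :=
  continuousOn_univ.1 (hρ.contDiffOn.continuousOn.comp (f := fun x => (s, x))
    (continuousOn_const.prodMk continuousOn_id) fun _ _ => ⟨hs, mem_univ _⟩)

theorem Z_pos (hρ : IsDensityPath ρ μ) {s : ℝ} (hs : s ∈ Icc (0 : ℝ) 1) : 0 < Z ρ s := by
  refine (integral_pos_iff_support_of_nonneg (fun x => (hρ.pos s hs x).le)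
    (hρ.integrable s hs)).2 ?_
  have : Function.support (ρ s) = univ := eq_univ_of_forall fun x => (hρ.pos s hs x).ne'
  rw [this]
  exact isOpen_univ.measure_pos _ univ_nonempty

theorem Z_zero (hρ : IsDensityPath ρ μ) [IsProbabilityMeasure μ] : Z ρ 0 = 1 := by
  have h0 : (0 : ℝ) ∈ Icc (0 : ℝ) 1 := by simp
  have h : μ univ = ENNReal.ofReal (Z ρ 0) := by
    rw [Z, ofReal_integral_eq_lintegral_ofReal (hρ.integrable 0 h0)
      (ae_of_all _ fun x => (hρ.pos 0 h0 x).le), hρ.initial, withDensity_apply _ .univ,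
      Measure.restrict_univ]
  rw [measure_univ] at h
  exact ENNReal.ofReal_eq_one.1 h.symm

theorem inner_score_eq (hρ : IsDensityPath ρ μ) {s : ℝ} (hs : s ∈ Icc (0 : ℝ) 1)
    (x w : State D) : inner ℝ (score ρ s x) w = logDifferential ρ (s, x) (0, w) := by
  have h1 : HasFDerivAt (fun y => Real.log (ρ s y))
      ((logDifferential ρ (s, x)).comp (ContinuousLinearMap.inr ℝ ℝ (State D))) x := by
    rw [← hasFDerivWithinAt_univ]
    exact (hρ.hasFDerivWithinAt_log hs x).comp (f := fun y => (s, y)) x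
      (hasFDerivAt_prodMk_right s x).hasFDerivWithinAt fun _ _ => ⟨hs, mem_univ _⟩
  have h2 : (fun y => Real.log (targetDensity ρ s y)) =
      fun y => Real.log (ρ s y) - Real.log (Z ρ s) := by
    funext y
    exact Real.log_div (hρ.pos s hs y).ne' (hρ.Z_pos hs).ne'
  rw [score, gradient, h2, fderiv_sub_const, h1.fderiv, InnerProductSpace.toDual_symm_apply]
  simp

theorem continuousOn_score_add_dtLog (hρ : IsDensityPath ρ μ) {v X : ℝ → State D → State D}
    (hv : IsVelocityField v) (hX : IsTrajectory v X) (y : State D) :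
    ContinuousOn (fun s => inner ℝ (score ρ s (X s y)) (v s (X s y)) + dtLog ρ s (X s y))
      (Icc 0 1) := by
  have hc : ContinuousOn (fun s => (s, X s y)) (Icc (0 : ℝ) 1) :=
    continuousOn_id.prodMk (hX.continuousOn y)
  have hm : MapsTo (fun s => (s, X s y)) (Icc (0 : ℝ) 1) (Icc (0 : ℝ) 1 ×ˢ univ) :=
    fun s hs => ⟨hs, mem_univ _⟩
  refine ContinuousOn.add ?_ (hρ.continuousOn_dtLog.comp hc hm)
  refine ContinuousOn.congr (f := fun s => logDifferential ρ (s, X s y) (0, v s (X s y))) ?_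
    fun s hs => hρ.inner_score_eq hs _ _
  exact (hρ.continuousOn_logDifferential.comp hc hm).clm_apply
    (continuousOn_const.prodMk (hv.continuousOn.comp hc hm))

theorem integral_score_add_dtLog (hρ : IsDensityPath ρ μ) {v X : ℝ → State D → State D}
    (hv : IsVelocityField v) (hX : IsTrajectory v X) (y : State D) {t : ℝ}
    (ht : t ∈ Icc (0 : ℝ) 1) :
    ∫ s in (0 : ℝ)..t, (inner ℝ (score ρ s (X s y)) (v s (X s y)) + dtLog ρ s (X s y)) =
      Real.log (ρ t (X t y)) - Real.log (ρ 0 y) := by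
  have hsub : Icc 0 t ⊆ Icc (0 : ℝ) 1 := Icc_subset_Icc_right ht.2
  have hd : ∀ s ∈ Icc (0 : ℝ) 1, HasDerivWithinAt (fun s => Real.log (ρ s (X s y)))
      (inner ℝ (score ρ s (X s y)) (v s (X s y)) + dtLog ρ s (X s y)) (Icc 0 1) s := by
    intro s hs
    refine (hρ.hasDerivWithinAt_log hs (hX.hasDerivWithinAt y s hs)).congr_deriv ?_
    rw [hρ.inner_score_eq hs, hρ.dtLog_eq hs, ← map_add]
    simp
  rw [intervalIntegral.integral_eq_sub_of_hasDerivAt_of_le ht.1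
    (f := fun s => Real.log (ρ s (X s y)))
    (fun s hs => ((hd s (hsub hs)).continuousWithinAt).mono hsub)
    (fun s hs => (hd s (hsub (Ioo_subset_Icc_self hs))).hasDerivAt
      (Icc_mem_nhds hs.1 (hs.2.trans_le ht.2)))
    (((hρ.continuousOn_score_add_dtLog hv hX y).mono hsub).intervalIntegrable_of_Icc ht.1),
    hX.initial]

theorem hasDerivWithinAt (hρ : IsDensityPath ρ μ) {s : ℝ} (hs : s ∈ Icc (0 : ℝ) 1)
    (x : State D) :
    HasDerivWithinAt (fun u => ρ u x) (dtLog ρ s x * ρ s x) (Icc 0 1) s := by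
  have h := (hρ.hasDerivWithinAt_log (c := fun _ => x) hs (hasDerivWithinAt_const s _ x)).exp
  rw [Real.exp_log (hρ.pos s hs x), ← hρ.dtLog_eq hs, mul_comm] at h
  exact h.congr (fun u hu => (Real.exp_log (hρ.pos u hu x)).symm)
    (Real.exp_log (hρ.pos s hs x)).symm

theorem continuousOn_dtLog_mul (hρ : IsDensityPath ρ μ) (x : State D) :
    ContinuousOn (fun s => dtLog ρ s x * ρ s x) (Icc 0 1) :=
  (hρ.continuousOn_dtLog.mul hρ.contDiffOn.continuousOn).comp (f := fun s => (s, x))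
    (continuousOn_id.prodMk continuousOn_const) fun _ hs => ⟨hs, mem_univ _⟩

theorem continuous_dtLog_mul (hρ : IsDensityPath ρ μ) {s : ℝ} (hs : s ∈ Icc (0 : ℝ) 1) :
    Continuous (fun x => dtLog ρ s x * ρ s x) :=
  (hρ.continuous_dtLog hs).mul (hρ.continuous_apply hs)

theorem abs_dtLog_mul_le (hρ : IsDensityPath ρ μ) {t M : ℝ} (ht : t ∈ Icc (0 : ℝ) 1)
    (hM : ∀ s ∈ Icc (0 : ℝ) t, ∀ x, |dtLog ρ s x| ≤ M) {s : ℝ} (hs : s ∈ Icc (0 : ℝ) t)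
    (x : State D) : |dtLog ρ s x * ρ s x| ≤ M * (Real.exp M * ρ 0 x) := by
  have hsub : Icc 0 t ⊆ Icc (0 : ℝ) 1 := Icc_subset_Icc_right ht.2
  have h0 : (0 : ℝ) ∈ Icc (0 : ℝ) t := left_mem_Icc.2 ht.1
  have hM0 : 0 ≤ M := (abs_nonneg _).trans (hM 0 h0 x)
  have hd : ∀ u ∈ Icc (0 : ℝ) t,
      HasDerivWithinAt (fun u => Real.log (ρ u x)) (dtLog ρ u x) (Icc 0 t) u := fun u hu => by
    rw [hρ.dtLog_eq (hsub hu)]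
    exact (hρ.hasDerivWithinAt_log (c := fun _ => x) (hsub hu)
      (hasDerivWithinAt_const u _ x)).mono hsub
  have hle := (convex_Icc 0 t).norm_image_sub_le_of_norm_hasDerivWithin_le hd
    (fun u hu => hM u hu x) h0 hs
  have hpos := hρ.pos s (hsub hs) x
  have hpos0 := hρ.pos 0 (hsub h0) x
  have hlog : Real.log (ρ s x) ≤ M + Real.log (ρ 0 x) := by
    have h1 := (le_abs_self _).trans hle
    have h2 : ‖s - 0‖ ≤ 1 := by
      rw [sub_zero, Real.norm_eq_abs, abs_of_nonneg hs.1]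
      exact hs.2.trans ht.2
    nlinarith
  have hρle : ρ s x ≤ Real.exp M * ρ 0 x := by
    rw [← Real.exp_log hpos0, ← Real.exp_add, ← Real.exp_log hpos]
    exact Real.exp_le_exp.2 hlog
  rw [abs_mul, abs_of_pos hpos]
  exact mul_le_mul (hM s hs x) hρle hpos.le hM0

theorem continuousOn_integral_dtLog_mul (hρ : IsDensityPath ρ μ) {t M : ℝ}
    (ht : t ∈ Icc (0 : ℝ) 1) (hM : ∀ s ∈ Icc (0 : ℝ) t, ∀ x, |dtLog ρ s x| ≤ M) :
    ContinuousOn (fun s => ∫ x, dtLog ρ s x * ρ s x) (Icc 0 t) := by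
  have hsub : Icc 0 t ⊆ Icc (0 : ℝ) 1 := Icc_subset_Icc_right ht.2
  exact continuousOn_of_dominated
    (fun s hs => (hρ.continuous_dtLog_mul (hsub hs)).aestronglyMeasurable)
    (fun s hs => ae_of_all _ (hρ.abs_dtLog_mul_le ht hM hs))
    (((hρ.integrable 0 (by simp)).const_mul _).const_mul _)
    (ae_of_all _ fun x => (hρ.continuousOn_dtLog_mul x).mono hsub)

/-- Differentiation of the normalization constant under the integral sign. -/
theorem hasDerivWithinAt_Z (hρ : IsDensityPath ρ μ) {t M : ℝ}
    (ht : t ∈ Icc (0 : ℝ) 1) (hM : ∀ s ∈ Icc (0 : ℝ) t, ∀ x, |dtLog ρ s x| ≤ M) {s : ℝ}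
    (hs : s ∈ Icc (0 : ℝ) t) :
    HasDerivWithinAt (Z ρ) (∫ x, dtLog ρ s x * ρ s x) (Icc 0 t) s := by
  have hsub : Icc 0 t ⊆ Icc (0 : ℝ) 1 := Icc_subset_Icc_right ht.2
  rw [hasDerivWithinAt_iff_tendsto_slope]
  have hmem : ∀ᶠ u in nhdsWithin s (Icc 0 t \ {s}), u ∈ Icc 0 t \ {s} :=
    eventually_mem_nhdsWithin
  have hslope : ∀ u ∈ Icc 0 t \ {s}, ∫ x, slope (fun u => ρ u x) s u = slope (Z ρ) s u := by
    intro u hu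
    simp only [slope_def_module]
    rw [integral_smul, integral_sub (hρ.integrable u (hsub hu.1)) (hρ.integrable s (hsub hs))]
    rfl
  refine Filter.Tendsto.congr' (hmem.mono hslope) ?_
  refine tendsto_integral_filter_of_dominated_convergence
    (fun x => M * (Real.exp M * ρ 0 x)) (hmem.mono fun u hu => ?_) (hmem.mono fun u hu => ?_)
    (((hρ.integrable 0 (by simp)).const_mul _).const_mul _) (ae_of_all _ fun x => ?_)
  · simp only [slope_def_module]
    exact (((hρ.continuous_apply (hsub hu.1)).sub
      (hρ.continuous_apply (hsub hs))).const_smul (u - s)⁻¹).aestronglyMeasurable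
  · refine ae_of_all _ fun x => ?_
    have hle := (convex_Icc 0 t).norm_image_sub_le_of_norm_hasDerivWithin_le
      (fun u hu => (hρ.hasDerivWithinAt (hsub hu) x).mono hsub)
      (fun u hu => hρ.abs_dtLog_mul_le ht hM hu x) hs hu.1
    have hne : 0 < ‖u - s‖ := norm_pos_iff.2 (sub_ne_zero.2 hu.2)
    rw [slope_def_module, norm_smul, norm_inv, inv_mul_le_iff₀ hne, mul_comm]
    exact hle
  · exact hasDerivWithinAt_iff_tendsto_slope.1 ((hρ.hasDerivWithinAt (hsub hs) x).mono hsub)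

theorem measurable_targetDensity (hρ : IsDensityPath ρ μ) {s : ℝ} (hs : s ∈ Icc (0 : ℝ) 1) :
    Measurable (targetDensity ρ s) :=
  ((hρ.continuous_apply hs).div_const _).measurable

theorem integral_target (hρ : IsDensityPath ρ μ) {s : ℝ} (hs : s ∈ Icc (0 : ℝ) 1)
    (g : State D → ℝ) : ∫ x, g x ∂(target ρ s) = (∫ x, g x * ρ s x) / Z ρ s := by
  have hnn : ∀ x, 0 ≤ targetDensity ρ s x := fun x =>
    div_nonneg (hρ.pos s hs x).le (hρ.Z_pos hs).le
  rw [target, integral_withDensity_eq_integral_toReal_smul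
    (hρ.measurable_targetDensity hs).ennreal_ofReal (ae_of_all _ fun _ => ENNReal.ofReal_lt_top),
    ← integral_div]
  refine integral_congr_ae (ae_of_all _ fun x => ?_)
  simp only [ENNReal.toReal_ofReal (hnn x)]
  simp only [targetDensity, smul_eq_mul]
  ring

theorem continuousOn_integral_dtLog (hρ : IsDensityPath ρ μ) {t M : ℝ}
    (ht : t ∈ Icc (0 : ℝ) 1) (hM : ∀ s ∈ Icc (0 : ℝ) t, ∀ x, |dtLog ρ s x| ≤ M) :
    ContinuousOn (fun s => ∫ x, dtLog ρ s x ∂(target ρ s)) (Icc 0 t) := by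
  have hsub : Icc 0 t ⊆ Icc (0 : ℝ) 1 := Icc_subset_Icc_right ht.2
  refine ((hρ.continuousOn_integral_dtLog_mul ht hM).div
    (fun s hs => (hρ.hasDerivWithinAt_Z ht hM hs).continuousWithinAt)
    fun s hs => (hρ.Z_pos (hsub hs)).ne').congr fun s hs => ?_
  exact hρ.integral_target (hsub hs) _

/-- Thermodynamic integration: the logarithm of the normalization constant is the integral of
the expected logarithmic time derivative. -/
theorem integral_integral_dtLog (hρ : IsDensityPath ρ μ) [IsProbabilityMeasure μ] {t M : ℝ}
    (ht : t ∈ Icc (0 : ℝ) 1) (hM : ∀ s ∈ Icc (0 : ℝ) t, ∀ x, |dtLog ρ s x| ≤ M) :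
    ∫ s in (0 : ℝ)..t, ∫ x, dtLog ρ s x ∂(target ρ s) = Real.log (Z ρ t) := by
  have hsub : Icc 0 t ⊆ Icc (0 : ℝ) 1 := Icc_subset_Icc_right ht.2
  have hd : ∀ s ∈ Icc (0 : ℝ) t, HasDerivWithinAt (fun s => Real.log (Z ρ s))
      (∫ x, dtLog ρ s x ∂(target ρ s)) (Icc 0 t) s := fun s hs => by
    rw [hρ.integral_target (hsub hs)]
    exact (hρ.hasDerivWithinAt_Z ht hM hs).log (hρ.Z_pos (hsub hs)).ne'
  rw [intervalIntegral.integral_eq_sub_of_hasDerivAt_of_le ht.1 (f := fun s => Real.log (Z ρ s))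
    (fun s hs => (hd s hs).continuousWithinAt)
    (fun s hs => (hd s (Ioo_subset_Icc_self hs)).hasDerivAt (Icc_mem_nhds hs.1 hs.2))
    ((hρ.continuousOn_integral_dtLog ht hM).intervalIntegrable_of_Icc ht.1),
    hρ.Z_zero, Real.log_one, sub_zero]

end IsDensityPath

end densityPath

section weights

variable {D : ℕ} {ρ : ℝ → State D → ℝ} {μ : Measure (State D)} {v X : ℝ → State D → State D}

theorem IsTrajectory.continuous (hv : IsVelocityField v) (hX : IsTrajectory v X) {t : ℝ}
    (ht : t ∈ Icc (0 : ℝ) 1) : Continuous (X t) :=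
  continuous_iff_continuousAt.2 fun x =>
    let ⟨_, hJ, _⟩ := hX.exists_hasFDerivAt hv x ht
    hJ.continuousAt

namespace IsDensityPath

theorem intervalIntegrable_modErr (hρ : IsDensityPath ρ μ) (hv : IsVelocityField v)
    (hX : IsTrajectory v X) {t : ℝ} (ht : t ∈ Icc (0 : ℝ) 1) (y : State D) :
    IntervalIntegrable (fun s => modErr ρ v s (X s y)) volume 0 t := by
  have h : ContinuousOn (fun s => modErr ρ v s (X s y)) (Icc 0 1) := by
    simp only [modErr, add_assoc]
    exact (hv.continuousOn_divergence hX y).add (hρ.continuousOn_score_add_dtLog hv hX y)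
  exact (h.mono (Icc_subset_Icc_right ht.2)).intervalIntegrable_of_Icc ht.1

theorem err_eq (ρ : ℝ → State D → ℝ) (v : ℝ → State D → State D) (s : ℝ) (x : State D) :
    err ρ v s x = modErr ρ v s x - ∫ y, dtLog ρ s y ∂(target ρ s) := by
  rw [err, modErr]
  ring

/-- Change of variables along the flow: the modified weight transports the initial density to
the unnormalized target density. -/
theorem mul_modWeight_eq (hρ : IsDensityPath ρ μ) (hv : IsVelocityField v)
    (hX : IsTrajectory v X) {t : ℝ} (ht : t ∈ Icc (0 : ℝ) 1) (y : State D) :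
    ρ 0 y * modWeight ρ v X t y = |(fderiv ℝ (X t) y).det| * ρ t (X t y) := by
  obtain ⟨J, hJ, hdet⟩ := hX.exists_hasFDerivAt hv y ht
  have hsub : Icc 0 t ⊆ Icc (0 : ℝ) 1 := Icc_subset_Icc_right ht.2
  rw [hJ.fderiv, hdet, abs_of_pos (Real.exp_pos _), modWeight]
  simp only [modErr, add_assoc]
  rw [intervalIntegral.integral_add
    (((hv.continuousOn_divergence hX y).mono hsub).intervalIntegrable_of_Icc ht.1)
    (((hρ.continuousOn_score_add_dtLog hv hX y).mono hsub).intervalIntegrable_of_Icc ht.1),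
    hρ.integral_score_add_dtLog hv hX y ht, Real.exp_add, Real.exp_sub,
    Real.exp_log (hρ.pos t ht _), Real.exp_log (hρ.pos 0 (by simp) _)]
  have := (hρ.pos 0 (by simp) y).ne'
  field_simp

/-- The flow reaches almost every point as soon as the target is dominated by the induced
distribution. -/
theorem ae_mem_range (hρ : IsDensityPath ρ μ) (hv : IsVelocityField v) (hX : IsTrajectory v X)
    {t : ℝ} (ht : t ∈ Icc (0 : ℝ) 1) (h_dom : target ρ t ≪ induced μ X t) :
    ∀ᵐ x : State D, x ∈ range (X t) := by
  have hcont := hX.continuous hv ht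
  have hms : MeasurableSet (range (X t)) :=
    (hcont.measurableEmbedding (hX.injective hv ht)).measurableSet_range
  have h1 : induced μ X t (range (X t))ᶜ = 0 := by
    rw [induced, Measure.map_apply hcont.measurable hms.compl]
    have : X t ⁻¹' (range (X t))ᶜ = ∅ := by
      ext x
      simp
    rw [this, measure_empty]
  have hac : (volume : Measure (State D)) ≪ target ρ t :=
    withDensity_absolutelyContinuous' (hρ.measurable_targetDensity ht).ennreal_ofReal.aemeasurable
      (ae_of_all _ fun x => by
        exact (ENNReal.ofReal_pos.2 (div_pos (hρ.pos t ht x) (hρ.Z_pos ht))).ne')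
  exact hac (h_dom h1)

theorem integrable_modWeight_and_integral_eq (hρ : IsDensityPath ρ μ) (hv : IsVelocityField v)
    (hX : IsTrajectory v X) {t : ℝ} (ht : t ∈ Icc (0 : ℝ) 1)
    (h_dom : target ρ t ≪ induced μ X t) :
    Integrable (modWeight ρ v X t) μ ∧ ∫ y, modWeight ρ v X t y ∂μ = Z ρ t := by
  have h0 : (0 : ℝ) ∈ Icc (0 : ℝ) 1 := by simp
  have hrestr : (volume : Measure (State D)).restrict (X t '' univ) = volume := by
    rw [image_univ]
    exact Measure.restrict_eq_self_of_ae_mem (hρ.ae_mem_range hv hX ht h_dom)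
  have hder : ∀ x ∈ (univ : Set (State D)),
      HasFDerivWithinAt (X t) (fderiv ℝ (X t) x) univ x := fun x _ =>
    let ⟨_, hJ, _⟩ := hX.exists_hasFDerivAt hv x ht
    hJ.differentiableAt.hasFDerivAt.hasFDerivWithinAt
  have hinj := (hX.injective hv ht).injOn (s := univ)
  have hmeas : Measurable fun x => ENNReal.ofReal (ρ 0 x) :=
    (hρ.continuous_apply h0).measurable.ennreal_ofReal
  have hfin : ∀ᵐ x : State D, ENNReal.ofReal (ρ 0 x) < ⊤ :=
    ae_of_all _ fun _ => ENNReal.ofReal_lt_top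
  have heq : (fun x => (ENNReal.ofReal (ρ 0 x)).toReal • modWeight ρ v X t x) =
      fun x => |(fderiv ℝ (X t) x).det| • ρ t (X t x) := by
    funext x
    rw [ENNReal.toReal_ofReal (hρ.pos 0 h0 x).le, smul_eq_mul, smul_eq_mul,
      hρ.mul_modWeight_eq hv hX ht]
  rw [hρ.initial]
  constructor
  · rw [integrable_withDensity_iff_integrable_smul' hmeas hfin, heq, ← integrableOn_univ,
      ← integrableOn_image_iff_integrableOn_abs_det_fderiv_smul volume .univ hder hinj (ρ t),
      IntegrableOn, hrestr]
    exact hρ.integrable t ht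
  · rw [integral_withDensity_eq_integral_toReal_smul hmeas hfin, heq, ← setIntegral_univ,
      ← integral_image_eq_integral_abs_det_fderiv_smul volume .univ hder hinj (ρ t), hrestr, Z]

end IsDensityPath

end weights

end LFIS

theorem theorem3 {D : ℕ} (ρ : ℝ → LFIS.State D → ℝ) (μ : Measure (LFIS.State D))
    [IsProbabilityMeasure μ] (hρ : LFIS.IsDensityPath ρ μ)
    (v : ℝ → LFIS.State D → LFIS.State D) (hv : LFIS.IsVelocityField v)
    (X : ℝ → LFIS.State D → LFIS.State D) (hX : LFIS.IsTrajectory v X)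
    (t : ℝ) (ht : t ∈ Icc (0 : ℝ) 1)
    (h_int : ∀ s ∈ Icc (0 : ℝ) t, Integrable (LFIS.dtLog ρ s) (LFIS.target ρ s))
    (h_dom : LFIS.target ρ t ≪ LFIS.induced μ X t)
    (h_weight : ∃ M₁ : ℝ, ∀ s ∈ Icc (0 : ℝ) t, ∀ x₀, |LFIS.weight ρ v X s x₀| < M₁)
    (h_dtLog : ∃ M₂ : ℝ, ∀ s ∈ Icc (0 : ℝ) t, ∀ x, |LFIS.dtLog ρ s x| < M₂)
    {Ω : Type*} [MeasurableSpace Ω] (P : Measure Ω) [IsProbabilityMeasure P]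
    (N : ℕ) (hN : 0 < N) (x₀ : Fin N → Ω → LFIS.State D)
    (h_law : ∀ i, HasLaw (x₀ i) μ P) (h_indep : iIndepFun x₀ P) :
    (∀ y, IntervalIntegrable (fun s => LFIS.modErr ρ v s (X s y)) volume 0 t ∧
      IntervalIntegrable (fun s => LFIS.err ρ v s (X s y)) volume 0 t ∧
      LFIS.modWeight ρ v X t y = LFIS.weight ρ v X t y * LFIS.Z ρ t) ∧
    Integrable (fun ω => LFIS.estimator ρ v X t (fun i => x₀ i ω)) P ∧
    ∫ ω, LFIS.estimator ρ v X t (fun i => x₀ i ω) ∂P = LFIS.Z ρ t := by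
  obtain ⟨M, hM⟩ := h_dtLog
  have hM' : ∀ s ∈ Icc (0 : ℝ) t, ∀ x, |LFIS.dtLog ρ s x| ≤ M := fun s hs x => (hM s hs x).le
  have hE : IntervalIntegrable (fun s => ∫ x, LFIS.dtLog ρ s x ∂(LFIS.target ρ s)) volume 0 t :=
    (hρ.continuousOn_integral_dtLog ht hM').intervalIntegrable_of_Icc ht.1
  obtain ⟨hint, hval⟩ := hρ.integrable_modWeight_and_integral_eq hv hX ht h_dom
  have hi : ∀ i, Integrable (fun ω => LFIS.modWeight ρ v X t (x₀ i ω)) P := fun i => by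
    rw [← (h_law i).map_eq] at hint
    exact hint.comp_aemeasurable (h_law i).aemeasurable
  have hv' : ∀ i, ∫ ω, LFIS.modWeight ρ v X t (x₀ i ω) ∂P = LFIS.Z ρ t := fun i =>
    ((h_law i).integral_comp hint.aestronglyMeasurable).trans hval
  refine ⟨fun y => ?_, ?_, ?_⟩
  · have hmod := hρ.intervalIntegrable_modErr hv hX ht y
    refine ⟨hmod, ?_, ?_⟩
    · simp only [LFIS.IsDensityPath.err_eq]
      exact hmod.sub hE
    · simp only [LFIS.modWeight, LFIS.weight, LFIS.IsDensityPath.err_eq]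
      rw [intervalIntegral.integral_sub hmod hE, hρ.integral_integral_dtLog ht hM',
        Real.exp_sub, Real.exp_log (hρ.Z_pos ht)]
      have := (hρ.Z_pos ht).ne'
      field_simp
  · exact (integrable_finsetSum _ fun i _ => hi i).const_mul _
  · simp only [LFIS.estimator]
    rw [integral_const_mul, integral_finsetSum _ fun i _ => hi i]
    simp only [hv', Finset.sum_const, Finset.card_univ, Fintype.card_fin, nsmul_eq_mul]
    have : (N : ℝ) ≠ 0 := by exact_mod_cast hN.ne'
    field_simp
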